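/- Let $c_0$ be the real Banach space of real null sequences with the supremum norm, and let $X = c_0 \oplus_2 c_0$, i.e. $c_0\times c_0$ with the norm $\|(x,y)\| = (\|x\|^2+\|y\|^2)^{1/2}$. Regard every normed space as a subspace of its bidual through the canonical embedding. Then the following hold. 1. $X$ is a strict u-ideal in its bidual: $X^{***} = X^{\perp}\oplus X^{*}$, where $X^\perp\subseteq X^{***}$ is the annihilator of $X\subseteq X^{**}$, and $\|x+z\|=\|x-z\|$ for all $x\in X^\perp$, $z\in X^*$. 2. $X$ has the diameter 2 property: every nonempty relatively weakly open subset of the closed unit ball of $X$ has diameter $2$. 3. $X^*$ is not an $L$-summand in $X^{***}$: there is no subspace $Z$ of $X^{***}$ with $X^{***}=X^*\oplus Z$ and $\|x+z\|=\|x\|+\|z\|$ for all $x\in X^*$, $z\in Z$. 4. $\sup_{n\ge 0}\dim Z(X^{(2n)})=1$. Here $X^{(0)}=X$, $X^{(2n+2)}=(X^{(2n)})^{**}$, and the centralizer $Z(Y)$ of a real Banach space $Y$ is the space of bounded operators $T$ on $Y$ for which every extreme point $p$ of the unit ball of $Y^*$ satisfies $p\circ T = a_T(p)\,p$ for some scalar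 $a_T(p)$, and for which there is a bounded operator $S$ on $Y$ with $p\circ S = \overline{a_T(p)}\,p$ for all such $p$ (for real scalars one may take $S=T$). 5. $X$ is not a uniform algebra: for $\mathbb K=\mathbb R$ and for $\mathbb K=\mathbb C$, $X$ is not isometrically isomorphic, as a real Banach space, to a closed subalgebra of $C(K,\mathbb K)$, $K$ compact Hausdorff, that contains the constants and separates the points of $K$. 6. $X$ lacks the Daugavet property: there is a bounded operator $T:X\to X$ of rank one with $\|I+T\|\ne 1+\|T\|$. -/

import Mathlib

set_option maxSynthPendingDepth 3

open scoped ZeroAtInfty ENNReal ComplexConjugate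

noncomputable section

universe u

/-- The real Banach space `c₀ ⊕₂ c₀`; `C₀(ℕ, ℝ)` is the space of real null sequences
with the supremum norm. -/
abbrev CZeroSumTwo : Type := WithLp 2 (C₀(ℕ, ℝ) × C₀(ℕ, ℝ))

section Summands

variable (Y : Type u) [NormedAddCommGroup Y] [NormedSpace ℝ Y]

/-- `N` is an L-complement of `M` in `Y`: `Y = M ⊕ N` and `‖x + z‖ = ‖x‖ + ‖z‖`. -/
def IsLComplement (M N : Submodule ℝ Y) : Prop :=
  IsCompl M N ∧ ∀ x ∈ M, ∀ z ∈ N, ‖x + z‖ = ‖x‖ + ‖z‖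

/-- `M` is an L-summand in `Y`. -/
def IsLSummand (M : Submodule ℝ Y) : Prop :=
  ∃ N : Submodule ℝ Y, IsLComplement Y M N

/-- `N` is a u-complement of `M` in `Y`: `Y = M ⊕ N` and `‖x + z‖ = ‖x - z‖`. -/
def IsUComplement (M N : Submodule ℝ Y) : Prop :=
  IsCompl M N ∧ ∀ x ∈ M, ∀ z ∈ N, ‖x + z‖ = ‖x - z‖

/-- `M` is a u-summand in `Y`. -/
def IsUSummand (M : Submodule ℝ Y) : Prop :=
  ∃ N : Submodule ℝ Y, IsUComplement Y M N

/-- The annihilator of `M` in the dual of `Y`, that is, the functionals vanishing on `M`. -/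
abbrev annihilator (M : Submodule ℝ Y) : Submodule ℝ (StrongDual ℝ Y) :=
  StrongDual.polarSubmodule ℝ M

/-- `M` is a u-ideal in `Y`: its annihilator is a u-summand in the dual of `Y`. -/
def IsUIdeal (M : Submodule ℝ Y) : Prop :=
  IsUSummand (StrongDual ℝ Y) (annihilator Y M)

end Summands

section Properties

variable (X : Type u) [NormedAddCommGroup X] [NormedSpace ℝ X]

/-- The canonical copy of `X` in its bidual. -/
def canonicalImage : Submodule ℝ (StrongDual ℝ (StrongDual ℝ X)) :=
  (NormedSpace.inclusionInDoubleDual ℝ X).range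

/-- `X` is a strict u-ideal in its bidual: `X` is a u-ideal in `X**` and the u-complement of
`X^⊥` in `X***` is the canonical copy of `X*`. -/
def IsStrictUIdealInBidual : Prop :=
  IsUIdeal (StrongDual ℝ (StrongDual ℝ X)) (canonicalImage X) ∧
    IsUComplement (StrongDual ℝ (StrongDual ℝ (StrongDual ℝ X)))
      (annihilator (StrongDual ℝ (StrongDual ℝ X)) (canonicalImage X))
      (canonicalImage (StrongDual ℝ X))

/-- The diameter 2 property: every nonempty relatively weakly open subset of the closed unit ball
has diameter 2. -/
def HasDiameterTwoProperty : Prop :=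
  ∀ U : Set (WeakSpace ℝ X), IsOpen U →
    (toWeakSpace ℝ X ⁻¹' U ∩ Metric.closedBall (0 : X) 1).Nonempty →
      Metric.diam (toWeakSpace ℝ X ⁻¹' U ∩ Metric.closedBall (0 : X) 1) = 2

/-- The Daugavet property: `‖I + T‖ = 1 + ‖T‖` for every bounded operator `T` of rank one. -/
def HasDaugavetProperty : Prop :=
  ∀ T : X →L[ℝ] X, LinearMap.rank (T : X →ₗ[ℝ] X) = 1 →
    ‖ContinuousLinearMap.id ℝ X + T‖ = 1 + ‖T‖

/-- The real normed space `X` is a uniform algebra with scalars `𝕜`: it is isometrically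
isomorphic, over `ℝ`, to a closed subalgebra of some `C(K, 𝕜)`, `K` compact Hausdorff, which
contains the constants (subalgebras are unital) and separates the points of `K`. -/
def IsUniformAlgebra (𝕜 : Type) [RCLike 𝕜] : Prop :=
  ∃ (K : Type u) (_ : TopologicalSpace K) (_ : CompactSpace K) (_ : T2Space K)
    (A : Subalgebra 𝕜 C(K, 𝕜)),
    IsClosed (A : Set C(K, 𝕜)) ∧ A.SeparatesPoints ∧
      ∃ φ : X →ₗᵢ[ℝ] C(K, 𝕜), Set.range φ = (A : Set C(K, 𝕜))

/-- The extreme points of the closed unit ball of the dual of `X`. -/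
def dualExtremePoints : Set (StrongDual ℝ X) :=
  Set.extremePoints ℝ (Metric.closedBall (0 : StrongDual ℝ X) 1)

/-- The centralizer of `X`. A multiplier is a bounded operator `T` such that each extreme point
`p` of the dual ball satisfies `p ∘ T = a_T(p) p` for a scalar `a_T(p)`; the centralizer consists
of the multipliers `T` for which there is a multiplier `S` with `a_S(p) = conj (a_T(p))` for all
such `p`. -/
def centralizer : Submodule ℝ (X →L[ℝ] X) where
  carrier := {T | ∃ S : X →L[ℝ] X, ∀ p ∈ dualExtremePoints X,
    ∃ a : ℝ, p.comp T = a • p ∧ p.comp S = conj a • p}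
  zero_mem' := ⟨0, fun p _ => ⟨0, by simp, by simp⟩⟩
  add_mem' := by
    rintro T₁ T₂ ⟨S₁, h₁⟩ ⟨S₂, h₂⟩
    refine ⟨S₁ + S₂, fun p hp => ?_⟩
    obtain ⟨a, ha, ha'⟩ := h₁ p hp
    obtain ⟨b, hb, hb'⟩ := h₂ p hp
    exact ⟨a + b, by rw [ContinuousLinearMap.comp_add, ha, hb, add_smul],
      by rw [ContinuousLinearMap.comp_add, ha', hb', map_add, add_smul]⟩
  smul_mem' := by
    rintro c T ⟨S, h⟩
    refine ⟨conj c • S, fun p hp => ?_⟩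
    obtain ⟨a, ha, ha'⟩ := h p hp
    exact ⟨c * a, by rw [ContinuousLinearMap.comp_smul, ha, smul_smul],
      by rw [ContinuousLinearMap.comp_smul, ha', map_mul, smul_smul]⟩

end Properties

/-- A real normed space, bundled. -/
structure RealNormedSpace where
  carrier : Type u
  [group : NormedAddCommGroup carrier]
  [space : NormedSpace ℝ carrier]

attribute [instance] RealNormedSpace.group RealNormedSpace.space

/-- The even dual `X^{(2n)}`: `X^{(0)} = X` and `X^{(2n+2)}` is the bidual of `X^{(2n)}`. -/
def evenDual (X : Type u) [NormedAddCommGroup X] [NormedSpace ℝ X] : ℕ → RealNormedSpace.{u}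
  | 0 => ⟨X⟩
  | n + 1 => ⟨StrongDual ℝ (StrongDual ℝ (evenDual X n).carrier)⟩

end

/-!
An `ℓ²`-decomposition `X = E ⊕₂ F` induces one of every dual of `X`, so each of the six properties
is either inherited from the summands or decided by the `ℓ²`-geometry alone.

* Inherited from `c₀`. The coordinate truncations `T` satisfy `‖I - 2T‖ ≤ 1`, and `(I - 2T)***`
  fixes `X^⊥` and tends to `-I` pointwise on `X*`: this is the strict u-ideal property. The unit
  vectors are weakly null, so one coordinate of `x` can be moved to `±r`, with `‖x‖ ≤ r`, without
  leaving a given weak neighbourhood or the ball of radius `r`: this gives diameter two, and, with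
  `r = ‖x‖`, also local almost squareness. The latter excludes uniform algebras, whose unit
  satisfies `2 + 2‖v‖² ≤ ‖1 + v‖² + ‖1 - v‖²` by the parallelogram law at a peak of `|v|`.
* Decided by the `ℓ²`-geometry. The dual ball has the extreme points `s p + t q`, with `p` and `q`
  extreme in the summands and `s² + t² = 1`, which forces all eigenvalues of a multiplier to agree.
  If `‖a + z‖ = ‖a‖ + ‖z‖` with `0 ≠ a ∈ E`, then `z ∈ E`; hence an L-summand meeting both summands
  nontrivially is everything, but `X*` is a proper subspace of `X***` because `X` is not reflexive.
  A norm one operator of rank one from `E` to `F` has `‖I + T‖ ≤ √3 < 2`.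
-/

noncomputable section

open Filter Topology NormedSpace

section Transpose

variable {X Y : Type*} [NormedAddCommGroup X] [NormedSpace ℝ X]
  [NormedAddCommGroup Y] [NormedSpace ℝ Y]

/-- The transpose `f ↦ f ∘ T` of a bounded operator `T`, as an operator between the dual spaces;
it is bundled as a bounded linear function of `T`. -/
def transpose : (X →L[ℝ] Y) →L[ℝ] StrongDual ℝ Y →L[ℝ] StrongDual ℝ X :=
  (ContinuousLinearMap.compL ℝ X Y ℝ).flip

theorem transpose_apply_apply (T : X →L[ℝ] Y) (f : StrongDual ℝ Y) (x : X) :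
    transpose T f x = f (T x) := rfl

theorem transpose_id :
    transpose (ContinuousLinearMap.id ℝ X) = ContinuousLinearMap.id ℝ (StrongDual ℝ X) := rfl

theorem norm_transpose_le (T : X →L[ℝ] Y) : ‖transpose T‖ ≤ ‖T‖ :=
  ContinuousLinearMap.opNorm_le_bound _ (norm_nonneg T) fun f => by
    rw [mul_comm]
    exact f.opNorm_comp_le T

end Transpose

section CanonicalImage

variable {E X : Type*} [NormedAddCommGroup E] [NormedSpace ℝ E]
  [NormedAddCommGroup X] [NormedSpace ℝ X]

theorem inclusionInDoubleDual_ne_zero {x : X} (hx : x ≠ 0) : inclusionInDoubleDual ℝ X x ≠ 0 :=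
  fun h => hx ((map_eq_zero_iff _ (inclusionInDoubleDualLi ℝ).injective).1 h)

theorem mem_annihilator_canonicalImage {F : StrongDual ℝ (StrongDual ℝ (StrongDual ℝ X))} :
    F ∈ annihilator (StrongDual ℝ (StrongDual ℝ X)) (canonicalImage X) ↔
      ∀ x : X, F (inclusionInDoubleDual ℝ X x) = 0 := by
  rw [annihilator, StrongDual.mem_polarSubmodule]
  exact ⟨fun h x => h _ ⟨x, rfl⟩, by rintro h _ ⟨x, rfl⟩; exact h x⟩

theorem isCompl_annihilator_canonicalImage :
    IsCompl (annihilator (StrongDual ℝ (StrongDual ℝ X)) (canonicalImage X))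
      (canonicalImage (StrongDual ℝ X)) := by
  constructor
  · rw [Submodule.disjoint_def]
    rintro _ h ⟨f, rfl⟩
    have hf : f = 0 := ContinuousLinearMap.ext (mem_annihilator_canonicalImage.1 h)
    rw [hf]
    exact map_zero _
  · rw [codisjoint_iff, Submodule.eq_top_iff']
    intro F
    let f : StrongDual ℝ X := F.comp (inclusionInDoubleDual ℝ X)
    refine Submodule.mem_sup.2
      ⟨F - inclusionInDoubleDual ℝ _ f, ?_, inclusionInDoubleDual ℝ _ f, ⟨f, rfl⟩,
        sub_add_cancel _ _⟩
    exact mem_annihilator_canonicalImage.2 fun x => sub_self (f x)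

theorem isStrictUIdealInBidual_iff :
    IsStrictUIdealInBidual X ↔
      ∀ F ∈ annihilator (StrongDual ℝ (StrongDual ℝ X)) (canonicalImage X), ∀ f : StrongDual ℝ X,
        ‖F + inclusionInDoubleDual ℝ _ f‖ = ‖F - inclusionInDoubleDual ℝ _ f‖ := by
  refine ⟨fun h F hF f => h.2.2 F hF _ ⟨f, rfl⟩, fun h => ?_⟩
  have hU : IsUComplement (StrongDual ℝ (StrongDual ℝ (StrongDual ℝ X)))
      (annihilator (StrongDual ℝ (StrongDual ℝ X)) (canonicalImage X))
      (canonicalImage (StrongDual ℝ X)) :=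
    ⟨isCompl_annihilator_canonicalImage, by rintro F hF _ ⟨f, rfl⟩; exact h F hF f⟩
  exact ⟨⟨_, hU⟩, hU⟩

theorem canonicalImage_ne_top_of_leftInverse {i : E →L[ℝ] X} {p : X →L[ℝ] E}
    (hpi : Function.LeftInverse p i) (hE : canonicalImage E ≠ ⊤) : canonicalImage X ≠ ⊤ := by
  refine fun hX => hE (Submodule.eq_top_iff'.2 fun φ => ?_)
  obtain ⟨x, hx⟩ : transpose (transpose i) φ ∈ canonicalImage X := hX ▸ Submodule.mem_top
  refine ⟨p x, ContinuousLinearMap.ext fun f => ?_⟩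
  have hpf : transpose i (transpose p f) = f :=
    ContinuousLinearMap.ext fun e => congrArg f (hpi e)
  calc f (p x) = φ (transpose i (transpose p f)) := DFunLike.congr_fun hx (transpose p f)
    _ = φ f := by rw [hpf]

theorem exists_mem_annihilator_apply_ne_zero {M : Submodule ℝ X} (hM : IsClosed (M : Set X))
    {x : X} (hx : x ∉ M) : ∃ f ∈ annihilator X M, f x ≠ 0 := by
  have hx' : M.mkQL x ≠ 0 := fun h => hx ((Submodule.Quotient.mk_eq_zero M).1 h)
  obtain ⟨g, hg⟩ := SeparatingDual.exists_ne_zero (R := ℝ) hx'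
  refine ⟨g.comp M.mkQL, (StrongDual.mem_polarSubmodule (𝕜 := ℝ) M _).2 fun y hy => ?_, hg⟩
  have hy' : M.mkQL y = 0 := (Submodule.Quotient.mk_eq_zero M).2 hy
  rw [ContinuousLinearMap.comp_apply, hy', map_zero]

theorem canonicalImage_strongDual_ne_top [CompleteSpace X] (hX : canonicalImage X ≠ ⊤) :
    canonicalImage (StrongDual ℝ X) ≠ ⊤ := by
  intro htop
  obtain ⟨φ, hφ⟩ : ∃ φ, φ ∉ canonicalImage X := by
    simpa only [ne_eq, Submodule.eq_top_iff', not_forall] using hX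
  have hclosed : IsClosed (canonicalImage X : Set (StrongDual ℝ (StrongDual ℝ X))) :=
    (inclusionInDoubleDualLi ℝ (E := X)).isometry.isClosedEmbedding.isClosed_range
  obtain ⟨F, hF, hFφ⟩ := exists_mem_annihilator_apply_ne_zero hclosed hφ
  have hF0 : F = 0 :=
    Submodule.disjoint_def.1 isCompl_annihilator_canonicalImage.disjoint F hF
      (htop ▸ Submodule.mem_top)
  exact hFφ (congrArg (· φ) hF0)

end CanonicalImage

section WeaklyCompact

variable {X Y : Type*} [NormedAddCommGroup X] [NormedSpace ℝ X]
  [NormedAddCommGroup Y] [NormedSpace ℝ Y]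

/-- The weakly compact operators from `X` to `Y`, encoded through Gantmacher's theorem: `T` is
weakly compact if and only if `T**` maps `X**` into `Y`. -/
def weaklyCompactOperators (X Y : Type*) [NormedAddCommGroup X] [NormedSpace ℝ X]
    [NormedAddCommGroup Y] [NormedSpace ℝ Y] : Submodule ℝ (X →L[ℝ] Y) where
  carrier := {T | ∀ φ, transpose (transpose T) φ ∈ canonicalImage Y}
  zero_mem' φ := by simp only [map_zero, zero_apply, zero_mem]
  add_mem' hS hT φ := by
    simp only [map_add, add_apply]
    exact add_mem (hS φ) (hT φ)
  smul_mem' c T hT φ := by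
    simp only [map_smul, smul_apply]
    exact Submodule.smul_mem _ c (hT φ)

theorem smulRight_mem_weaklyCompactOperators (g : StrongDual ℝ X) (y : Y) :
    g.smulRight y ∈ weaklyCompactOperators X Y := fun φ => by
  refine ⟨φ g • y, ContinuousLinearMap.ext fun f => ?_⟩
  have hf : transpose (g.smulRight y) f = f y • g := by
    ext x
    simp [transpose_apply_apply, mul_comm]
  calc f (φ g • y) = f y * φ g := by rw [map_smul, smul_eq_mul, mul_comm]
    _ = φ (transpose (g.smulRight y) f) := by rw [hf, map_smul, smul_eq_mul]

theorem transpose_transpose_transpose_eq_zero {T : X →L[ℝ] Y}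
    (hT : T ∈ weaklyCompactOperators X Y) {F : StrongDual ℝ (StrongDual ℝ (StrongDual ℝ Y))}
    (hF : F ∈ annihilator (StrongDual ℝ (StrongDual ℝ Y)) (canonicalImage Y)) :
    transpose (transpose (transpose T)) F = 0 :=
  ContinuousLinearMap.ext fun φ =>
    (StrongDual.mem_polarSubmodule (𝕜 := ℝ) (canonicalImage Y) F).1 hF _ (hT φ)

theorem isStrictUIdealInBidual_of_tendsto {ι : Type*} {l : Filter ι} [l.NeBot]
    {T : ι → X →L[ℝ] X} (hnorm : ∀ i, ‖ContinuousLinearMap.id ℝ X - (2 : ℝ) • T i‖ ≤ 1)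
    (hcompact : ∀ i, T i ∈ weaklyCompactOperators X X)
    (hlim : ∀ f : StrongDual ℝ X, Tendsto (fun i => f.comp (T i)) l (𝓝 f)) :
    IsStrictUIdealInBidual X := by
  set j := inclusionInDoubleDual ℝ (StrongDual ℝ X)
  have norm_sub_le : ∀ F ∈ annihilator (StrongDual ℝ (StrongDual ℝ X)) (canonicalImage X),
      ∀ f, ‖F - j f‖ ≤ ‖F + j f‖ := by
    intro F hF f
    -- `(I - 2T)***` fixes `X^⊥` and converges to `-I` on `X*`.
    have happly (i : ι) : transpose (transpose (transpose
        (ContinuousLinearMap.id ℝ X - (2 : ℝ) • T i))) (F + j f) =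
          F + j f - (2 : ℝ) • j (f.comp (T i)) := by
      have hT : transpose (transpose (transpose (T i))) (F + j f) = j (f.comp (T i)) := by
        rw [map_add, transpose_transpose_transpose_eq_zero (hcompact i) hF, zero_add]
        rfl
      simp only [map_sub, map_smul, transpose_id, sub_apply, smul_apply,
        ContinuousLinearMap.id_apply, hT]
    have hle (i : ι) : ‖F + j f - (2 : ℝ) • j (f.comp (T i))‖ ≤ ‖F + j f‖ := by
      rw [← happly]
      refine ContinuousLinearMap.le_of_opNorm_le_of_le _ ?_ le_rfl |>.trans_eq (one_mul _)
      exact (((norm_transpose_le _).trans (norm_transpose_le _)).trans (norm_transpose_le _)).trans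
        (hnorm i)
    have htendsto : Tendsto (fun i => F + j f - (2 : ℝ) • j (f.comp (T i))) l
        (𝓝 (F + j f - (2 : ℝ) • j f)) :=
      tendsto_const_nhds.sub (((j.continuous.tendsto f).comp (hlim f)).const_smul 2)
    calc ‖F - j f‖ = ‖F + j f - (2 : ℝ) • j f‖ := by rw [two_smul]; abel_nf
      _ ≤ ‖F + j f‖ := le_of_tendsto' htendsto.norm hle
  refine isStrictUIdealInBidual_iff.2 fun F hF f => le_antisymm ?_ (norm_sub_le F hF f)
  simpa only [map_neg, sub_neg_eq_add, ← sub_eq_add_neg] using norm_sub_le F hF (-f)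

end WeaklyCompact

section L2Decomposition

/-- An `ℓ²`-decomposition of `X` with summands `E` and `F`: the inclusions and projections of an
identification of `X` with `E ⊕₂ F`. Unlike an isometry onto `WithLp 2 (E × F)`, these data pass
to the dual by taking transposes. -/
structure L2Decomposition (E F X : Type*) [NormedAddCommGroup E] [NormedSpace ℝ E]
    [NormedAddCommGroup F] [NormedSpace ℝ F] [NormedAddCommGroup X] [NormedSpace ℝ X] where
  inl : E →L[ℝ] X
  inr : F →L[ℝ] X
  fst : X →L[ℝ] E
  snd : X →L[ℝ] F
  fst_inl : ∀ a, fst (inl a) = a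
  snd_inr : ∀ b, snd (inr b) = b
  inl_fst_add_inr_snd : ∀ x, inl (fst x) + inr (snd x) = x
  norm_sq : ∀ x, ‖x‖ ^ 2 = ‖fst x‖ ^ 2 + ‖snd x‖ ^ 2

variable {E F X Y : Type*} [NormedAddCommGroup E] [NormedSpace ℝ E]
  [NormedAddCommGroup F] [NormedSpace ℝ F] [NormedAddCommGroup X] [NormedSpace ℝ X]
  [NormedAddCommGroup Y] [NormedSpace ℝ Y]

theorem norm_add_norm_le_of_forall_apply_add_apply_le {f : StrongDual ℝ X} {g : StrongDual ℝ Y}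
    {C : ℝ} (h : ∀ x y, ‖x‖ ≤ 1 → ‖y‖ ≤ 1 → f x + g y ≤ C) : ‖f‖ + ‖g‖ ≤ C := by
  have norm_apply_add_le {x : X} {y : Y} (hx : ‖x‖ ≤ 1) (hy : ‖y‖ ≤ 1) : ‖f x‖ + g y ≤ C := by
    rcases abs_choice (f x) with hfx | hfx <;> rw [Real.norm_eq_abs, hfx]
    · exact h x y hx hy
    · simpa only [map_neg] using h (-x) y (by rwa [norm_neg]) hy
  have norm_add_apply_le {y : Y} (hy : ‖y‖ ≤ 1) : ‖f‖ ≤ C - g y := by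
    refine f.opNorm_le_of_unit_norm ?_ fun x hx => le_sub_iff_add_le.2 (norm_apply_add_le hx.le hy)
    simpa using norm_apply_add_le (x := 0) (by simp) hy
  refine le_sub_iff_add_le'.1 (g.opNorm_le_of_unit_norm ?_ fun y hy => ?_)
  · simpa using norm_add_apply_le (y := 0) (by simp)
  · rcases abs_choice (g y) with hgy | hgy <;> rw [Real.norm_eq_abs, hgy]
    · linarith [norm_add_apply_le hy.le]
    · linarith [norm_add_apply_le (y := -y) (by rw [norm_neg, hy]), map_neg g y]

namespace L2Decomposition

variable (D : L2Decomposition E F X)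

/-- The decomposition with its two summands exchanged. -/
def symm : L2Decomposition F E X where
  inl := D.inr
  inr := D.inl
  fst := D.snd
  snd := D.fst
  fst_inl := D.snd_inr
  snd_inr := D.fst_inl
  inl_fst_add_inr_snd x := by rw [add_comm, D.inl_fst_add_inr_snd]
  norm_sq x := by rw [add_comm, D.norm_sq]

theorem snd_inl (a : E) : D.snd (D.inl a) = 0 := by
  have h : D.inl a + D.inr (D.snd (D.inl a)) = D.inl a := by
    simpa only [D.fst_inl] using D.inl_fst_add_inr_snd (D.inl a)
  rw [← D.snd_inr (D.snd (D.inl a)), add_eq_left.1 h, map_zero]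

theorem fst_inr (b : F) : D.fst (D.inr b) = 0 := D.symm.snd_inl b

theorem fst_inl_add_inr (a : E) (b : F) : D.fst (D.inl a + D.inr b) = a := by
  rw [map_add, D.fst_inl, D.fst_inr, add_zero]

theorem snd_inl_add_inr (a : E) (b : F) : D.snd (D.inl a + D.inr b) = b := by
  rw [map_add, D.snd_inl, D.snd_inr, zero_add]

theorem norm_inl_add_inr_sq (a : E) (b : F) : ‖D.inl a + D.inr b‖ ^ 2 = ‖a‖ ^ 2 + ‖b‖ ^ 2 := by
  rw [D.norm_sq, D.fst_inl_add_inr, D.snd_inl_add_inr]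

theorem norm_inl (a : E) : ‖D.inl a‖ = ‖a‖ := by
  rw [← sq_eq_sq₀ (norm_nonneg _) (norm_nonneg _), D.norm_sq, D.fst_inl, D.snd_inl, norm_zero]
  ring

theorem norm_inr (b : F) : ‖D.inr b‖ = ‖b‖ := D.symm.norm_inl b

theorem nontrivial [Nontrivial E] (D : L2Decomposition E F X) : Nontrivial X :=
  (Function.LeftInverse.injective D.fst_inl).nontrivial

/-- The defining decomposition of `E ⊕₂ F`. -/
def prod (E F : Type*) [NormedAddCommGroup E] [NormedSpace ℝ E] [NormedAddCommGroup F]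
    [NormedSpace ℝ F] : L2Decomposition E F (WithLp 2 (E × F)) where
  inl := (WithLp.prodContinuousLinearEquiv 2 ℝ E F).symm.toContinuousLinearMap.comp
    (ContinuousLinearMap.inl ℝ E F)
  inr := (WithLp.prodContinuousLinearEquiv 2 ℝ E F).symm.toContinuousLinearMap.comp
    (ContinuousLinearMap.inr ℝ E F)
  fst := WithLp.fstL 2 ℝ E F
  snd := WithLp.sndL 2 ℝ E F
  fst_inl _ := rfl
  snd_inr _ := rfl
  inl_fst_add_inr_snd x := WithLp.ofLp_injective 2 (by ext <;> simp)
  norm_sq := WithLp.prod_norm_sq_eq_of_L2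

theorem norm_apply_sq_le (f : StrongDual ℝ X) (x : X) :
    ‖f x‖ ^ 2 ≤ (‖f.comp D.inl‖ ^ 2 + ‖f.comp D.inr‖ ^ 2) * ‖x‖ ^ 2 := by
  have hfx : ‖f x‖ ≤ ‖f.comp D.inl‖ * ‖D.fst x‖ + ‖f.comp D.inr‖ * ‖D.snd x‖ :=
    calc ‖f x‖ = ‖f.comp D.inl (D.fst x) + f.comp D.inr (D.snd x)‖ := by
          conv_lhs => rw [← D.inl_fst_add_inr_snd x, map_add]
          rfl
      _ ≤ ‖f.comp D.inl‖ * ‖D.fst x‖ + ‖f.comp D.inr‖ * ‖D.snd x‖ :=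
        norm_add_le_of_le (ContinuousLinearMap.le_opNorm _ _) (ContinuousLinearMap.le_opNorm _ _)
  calc ‖f x‖ ^ 2
      ≤ (‖f.comp D.inl‖ * ‖D.fst x‖ + ‖f.comp D.inr‖ * ‖D.snd x‖) ^ 2 := by gcongr
    _ ≤ (‖f.comp D.inl‖ ^ 2 + ‖f.comp D.inr‖ ^ 2) * (‖D.fst x‖ ^ 2 + ‖D.snd x‖ ^ 2) := by
      linarith [sq_nonneg (‖f.comp D.inl‖ * ‖D.snd x‖ - ‖f.comp D.inr‖ * ‖D.fst x‖)]
    _ = _ := by rw [← D.norm_sq]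

theorem apply_inl_add_inr_le (f : StrongDual ℝ X) (a : E) (b : F) :
    f (D.inl a + D.inr b) ≤ ‖f‖ * √(‖a‖ ^ 2 + ‖b‖ ^ 2) := by
  rw [← D.norm_inl_add_inr_sq, Real.sqrt_sq (norm_nonneg _)]
  exact (le_abs_self _).trans (f.le_opNorm _)

theorem norm_dual_sq (f : StrongDual ℝ X) :
    ‖f‖ ^ 2 = ‖f.comp D.inl‖ ^ 2 + ‖f.comp D.inr‖ ^ 2 := by
  set g := f.comp D.inl
  set k := f.comp D.inr
  set R := √(‖g‖ ^ 2 + ‖k‖ ^ 2) with hR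
  have hR0 : 0 ≤ R := Real.sqrt_nonneg _
  have hRsq : R ^ 2 = ‖g‖ ^ 2 + ‖k‖ ^ 2 := Real.sq_sqrt (by positivity)
  have hle : ‖f‖ ≤ R := f.opNorm_le_bound hR0 fun x => by
    rw [← sq_le_sq₀ (norm_nonneg _) (by positivity), mul_pow, hRsq]
    exact D.norm_apply_sq_le f x
  have hsq_le : R ^ 2 ≤ ‖f‖ * R :=
    calc R ^ 2 = ‖‖g‖ • g‖ + ‖‖k‖ • k‖ := by
          rw [hRsq, norm_smul, norm_smul, norm_norm, norm_norm, sq, sq]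
      _ ≤ ‖f‖ * R := by
        refine norm_add_norm_le_of_forall_apply_add_apply_le fun a b ha hb => ?_
        calc (‖g‖ • g) a + (‖k‖ • k) b = f (D.inl (‖g‖ • a) + D.inr (‖k‖ • b)) := by
              simp only [map_add, map_smul]
              rfl
          _ ≤ ‖f‖ * √(‖‖g‖ • a‖ ^ 2 + ‖‖k‖ • b‖ ^ 2) := D.apply_inl_add_inr_le f _ _
          _ ≤ ‖f‖ * R := by
            rw [norm_smul, norm_smul, norm_norm, norm_norm, hR]
            gcongr
            · exact mul_le_of_le_one_right (norm_nonneg _) ha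
            · exact mul_le_of_le_one_right (norm_nonneg _) hb
  have hge : R ≤ ‖f‖ := by
    rcases hR0.eq_or_lt with h | h
    · exact h ▸ norm_nonneg f
    · exact le_of_mul_le_mul_right (by rwa [← sq]) h
  rw [← hRsq, le_antisymm hle hge]

/-- The dual decomposition `(E ⊕₂ F)* = E* ⊕₂ F*`. -/
def dual : L2Decomposition (StrongDual ℝ E) (StrongDual ℝ F) (StrongDual ℝ X) where
  inl := transpose D.fst
  inr := transpose D.snd
  fst := transpose D.inl
  snd := transpose D.inr
  fst_inl f := ContinuousLinearMap.ext fun a => congrArg f (D.fst_inl a)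
  snd_inr f := ContinuousLinearMap.ext fun b => congrArg f (D.snd_inr b)
  inl_fst_add_inr_snd f := ContinuousLinearMap.ext fun x => by
    conv_rhs => rw [← D.inl_fst_add_inr_snd x, map_add]
    rfl
  norm_sq := D.norm_dual_sq

/-- The induced decomposition `(E ⊕₂ F)^{(2n)} = E^{(2n)} ⊕₂ F^{(2n)}`. -/
def evenDual : ∀ n : ℕ, L2Decomposition (evenDual E n).carrier (evenDual F n).carrier
    (evenDual X n).carrier
  | 0 => D
  | n + 1 => (evenDual n).dual.dual

end L2Decomposition

instance instNontrivialEvenDual [Nontrivial E] (n : ℕ) : Nontrivial (evenDual E n).carrier := by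
  induction n with
  | zero => assumption
  | succ n ih => exact inferInstanceAs (Nontrivial (StrongDual ℝ (StrongDual ℝ _)))

namespace L2Decomposition

theorem isStrictUIdealInBidual (D : L2Decomposition E F X) (hE : IsStrictUIdealInBidual E)
    (hF : IsStrictUIdealInBidual F) : IsStrictUIdealInBidual X := by
  rw [isStrictUIdealInBidual_iff] at hE hF ⊢
  intro φ hφ f
  let D₃ := D.dual.dual.dual
  have hφ₁ : D₃.fst φ ∈ annihilator (StrongDual ℝ (StrongDual ℝ E)) (canonicalImage E) :=
    mem_annihilator_canonicalImage.2 fun a => mem_annihilator_canonicalImage.1 hφ (D.inl a)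
  have hφ₂ : D₃.snd φ ∈ annihilator (StrongDual ℝ (StrongDual ℝ F)) (canonicalImage F) :=
    mem_annihilator_canonicalImage.2 fun b => mem_annihilator_canonicalImage.1 hφ (D.inr b)
  have hf₁ : D₃.fst (inclusionInDoubleDual ℝ _ f) = inclusionInDoubleDual ℝ _ (D.dual.fst f) := rfl
  have hf₂ : D₃.snd (inclusionInDoubleDual ℝ _ f) = inclusionInDoubleDual ℝ _ (D.dual.snd f) := rfl
  rw [← sq_eq_sq₀ (norm_nonneg _) (norm_nonneg _), D₃.norm_sq, D₃.norm_sq]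
  simp only [map_add, map_sub, hf₁, hf₂, hE _ hφ₁, hF _ hφ₂]

end L2Decomposition

end L2Decomposition

section ExtremePoints

variable {E : Type*} [NormedAddCommGroup E] [NormedSpace ℝ E]

theorem exists_mem_extremePoints_apply_ne_zero {V : Type*} [AddCommGroup V] [Module ℝ V]
    [TopologicalSpace V] [IsTopologicalAddGroup V] [ContinuousSMul ℝ V] [LocallyConvexSpace ℝ V]
    [T2Space V] {K : Set V} (hK : IsCompact K) (hconv : Convex ℝ K) {φ : StrongDual ℝ V} {v : V}
    (hv : v ∈ K) (hφ : φ v ≠ 0) : ∃ p ∈ K.extremePoints ℝ, φ p ≠ 0 := by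
  by_contra! H
  have hker : K ⊆ φ.ker := by
    rw [← closure_convexHull_extremePoints hK hconv]
    exact closure_minimal (convexHull_min H φ.ker.convex) φ.isClosed_ker
  exact hφ (hker hv)

theorem exists_mem_dualExtremePoints_apply_ne_zero {w : E} (hw : w ≠ 0) :
    ∃ p ∈ dualExtremePoints E, p w ≠ 0 := by
  have : LocallyConvexSpace ℝ (WeakDual ℝ E) :=
    inferInstanceAs (LocallyConvexSpace ℝ (WeakBilin (topDualPairing ℝ E)))
  obtain ⟨g, hg, hgw⟩ := exists_dual_vector ℝ w (norm_ne_zero_iff.2 hw)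
  let K : Set (WeakDual ℝ E) := WeakDual.toStrongDual ⁻¹' Metric.closedBall 0 1
  have hconv : Convex ℝ K :=
    (convex_closedBall _ _).is_linear_preimage (WeakDual.toStrongDual (𝕜 := ℝ)).isLinear
  let evalAt : StrongDual ℝ (WeakDual ℝ E) :=
    ⟨(topDualPairing ℝ E).flip w, WeakDual.eval_continuous w⟩
  refine exists_mem_extremePoints_apply_ne_zero (WeakDual.isCompact_closedBall 0 1) hconv
    (φ := evalAt) (v := StrongDual.toWeakDual g) (mem_closedBall_zero_iff.2 hg.le) ?_
  exact hgw.trans_ne (by simpa using hw)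

theorem norm_eq_one_of_mem_extremePoints [Nontrivial E] {p : E}
    (hp : p ∈ (Metric.closedBall (0 : E) 1).extremePoints ℝ) : ‖p‖ = 1 :=
  mem_sphere_zero_iff_norm.1 (extremePoints_closedBall_subset_sphere hp)

theorem smul_mem_extremePoints_closedBall {p : E}
    (hp : p ∈ (Metric.closedBall (0 : E) 1).extremePoints ℝ) {s : ℝ} (hs : 0 ≤ s) :
    s • p ∈ (Metric.closedBall (0 : E) s).extremePoints ℝ := by
  rcases hs.eq_or_lt with rfl | hs'
  · simp
  · have himage := image_extremePoints (𝕜 := ℝ) (LinearEquiv.smulOfNeZero ℝ E s hs'.ne')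
      (Metric.closedBall (0 : E) 1)
    rw [← smul_unitClosedBall_of_nonneg hs]
    exact himage.subset ⟨p, hp, rfl⟩

theorem eq_and_eq_of_le_convexCombination {a b s t x y z w : ℝ} (ha : 0 < a) (hb : 0 < b)
    (hab : a + b = 1) (hs : 0 ≤ s) (ht : 0 ≤ t) (hst : s ^ 2 + t ^ 2 = 1)
    (hxy : x ^ 2 + y ^ 2 ≤ 1) (hzw : z ^ 2 + w ^ 2 ≤ 1)
    (hsx : s ≤ a * x + b * z) (hty : t ≤ a * y + b * w) : x = s ∧ y = t := by
  -- The functional `⟨(s, t), ·⟩` is at most one on the disc and at least one on the combination.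
  have hzw' : s * z + t * w ≤ 1 := by nlinarith [sq_nonneg (s - z), sq_nonneg (t - w)]
  have hcomb : 1 ≤ a * (s * x + t * y) + b * (s * z + t * w) := by
    nlinarith [mul_le_mul_of_nonneg_left hsx hs, mul_le_mul_of_nonneg_left hty ht]
  have hge : 1 ≤ s * x + t * y := by
    by_contra! h
    nlinarith [mul_lt_mul_of_pos_left h ha, mul_le_mul_of_nonneg_left hzw' hb.le]
  have hdist : (x - s) ^ 2 + (y - t) ^ 2 ≤ 0 := by nlinarith [hge, hxy]
  constructor
  · nlinarith [hdist, sq_nonneg (x - s), sq_nonneg (y - t)]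
  · nlinarith [hdist, sq_nonneg (x - s), sq_nonneg (y - t)]

theorem le_of_smul_add_smul_eq_smul [Nontrivial E] {p x z : E}
    (hp : p ∈ (Metric.closedBall (0 : E) 1).extremePoints ℝ) {a b s : ℝ} (ha : 0 ≤ a) (hb : 0 ≤ b)
    (h : a • x + b • z = s • p) : s ≤ a * ‖x‖ + b * ‖z‖ :=
  calc s ≤ ‖s • p‖ := by
        rw [norm_smul, norm_eq_one_of_mem_extremePoints hp, mul_one]
        exact Real.le_norm_self s
    _ = ‖a • x + b • z‖ := by rw [h]
    _ ≤ a * ‖x‖ + b * ‖z‖ := by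
        refine (norm_add_le _ _).trans_eq ?_
        rw [norm_smul, norm_smul, Real.norm_of_nonneg ha, Real.norm_of_nonneg hb]

end ExtremePoints

section Centralizer

variable {E F X : Type*} [NormedAddCommGroup E] [NormedSpace ℝ E]
  [NormedAddCommGroup F] [NormedSpace ℝ F] [NormedAddCommGroup X] [NormedSpace ℝ X]

/-- `T` is a multiplier: every extreme point of the dual unit ball is an eigenvector of `T*`. -/
def IsMultiplier (T : X →L[ℝ] X) : Prop :=
  ∀ p ∈ dualExtremePoints X, ∃ a : ℝ, p.comp T = a • p

namespace L2Decomposition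

variable [Nontrivial E] [Nontrivial F]

theorem smul_inl_add_smul_inr_mem_extremePoints (D : L2Decomposition E F X) {p : E} {q : F}
    (hp : p ∈ (Metric.closedBall (0 : E) 1).extremePoints ℝ)
    (hq : q ∈ (Metric.closedBall (0 : F) 1).extremePoints ℝ) {s t : ℝ} (hs : 0 ≤ s) (ht : 0 ≤ t)
    (hst : s ^ 2 + t ^ 2 = 1) :
    s • D.inl p + t • D.inr q ∈ (Metric.closedBall (0 : X) 1).extremePoints ℝ := by
  have hsq {x : X} : ‖x‖ ≤ 1 ↔ ‖D.fst x‖ ^ 2 + ‖D.snd x‖ ^ 2 ≤ 1 := by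
    rw [← D.norm_sq, sq_le_one_iff₀ (norm_nonneg x)]
  rw [← map_smul D.inl, ← map_smul D.inr, mem_extremePoints_iff_left]
  simp only [mem_closedBall_zero_iff]
  constructor
  · rw [hsq, D.fst_inl_add_inr, D.snd_inl_add_inr, norm_smul, norm_smul,
      norm_eq_one_of_mem_extremePoints hp, norm_eq_one_of_mem_extremePoints hq, mul_one, mul_one,
      Real.norm_of_nonneg hs, Real.norm_of_nonneg ht, hst]
  · rintro x hx z hz ⟨a, b, ha, hb, hab, h⟩
    have hfst : a • D.fst x + b • D.fst z = s • p := by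
      rw [← map_smul, ← map_smul, ← map_add, h, D.fst_inl_add_inr]
    have hsnd : a • D.snd x + b • D.snd z = t • q := by
      rw [← map_smul, ← map_smul, ← map_add, h, D.snd_inl_add_inr]
    have hs_le := le_of_smul_add_smul_eq_smul hp ha.le hb.le hfst
    have ht_le := le_of_smul_add_smul_eq_smul hq ha.le hb.le hsnd
    obtain ⟨hx₁, hx₂⟩ := eq_and_eq_of_le_convexCombination ha hb hab hs ht hst (hsq.1 hx) (hsq.1 hz)
      hs_le ht_le
    obtain ⟨hz₁, hz₂⟩ := eq_and_eq_of_le_convexCombination hb ha ((add_comm b a).trans hab) hs ht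
      hst (hsq.1 hz) (hsq.1 hx) (hs_le.trans_eq (add_comm _ _)) (ht_le.trans_eq (add_comm _ _))
    have hfst_eq : D.fst x = s • p :=
      (mem_extremePoints_iff_left.1 (smul_mem_extremePoints_closedBall hp hs)).2
        _ (mem_closedBall_zero_iff.2 hx₁.le) _ (mem_closedBall_zero_iff.2 hz₁.le)
        ⟨a, b, ha, hb, hab, hfst⟩
    have hsnd_eq : D.snd x = t • q :=
      (mem_extremePoints_iff_left.1 (smul_mem_extremePoints_closedBall hq ht)).2
        _ (mem_closedBall_zero_iff.2 hx₂.le) _ (mem_closedBall_zero_iff.2 hz₂.le)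
        ⟨a, b, ha, hb, hab, hsnd⟩
    rw [← D.inl_fst_add_inr_snd x, hfst_eq, hsnd_eq]

theorem exists_common_eigenvalue (D : L2Decomposition E F X) {T : X →L[ℝ] X} (hT : IsMultiplier T)
    {p : StrongDual ℝ E} (hp : p ∈ dualExtremePoints E) {q : StrongDual ℝ F}
    (hq : q ∈ dualExtremePoints F) :
    ∃ c : ℝ, (D.dual.inl p).comp T = c • D.dual.inl p ∧
      (D.dual.inr q).comp T = c • D.dual.inr q := by
  have hp0 : p ≠ 0 :=
    norm_ne_zero_iff.1 ((norm_eq_one_of_mem_extremePoints hp).trans_ne one_ne_zero)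
  have hq0 : q ≠ 0 :=
    norm_ne_zero_iff.1 ((norm_eq_one_of_mem_extremePoints hq).trans_ne one_ne_zero)
  have hmem {s t : ℝ} := D.dual.smul_inl_add_smul_inr_mem_extremePoints hp hq (s := s) (t := t)
  obtain ⟨a, ha⟩ := hT (D.dual.inl p) (by simpa using! hmem zero_le_one le_rfl (by norm_num))
  obtain ⟨b, hb⟩ := hT (D.dual.inr q) (by simpa using! hmem le_rfl zero_le_one (by norm_num))
  obtain ⟨c, hc⟩ := hT _ (hmem (s := 3 / 5) (t := 4 / 5) (by norm_num) (by norm_num) (by norm_num))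
  rw [ContinuousLinearMap.add_comp, ContinuousLinearMap.smul_comp, ContinuousLinearMap.smul_comp,
    ha, hb] at hc
  simp only [← map_smul, smul_add, smul_smul] at hc
  have hac : 3 / 5 * a = c * (3 / 5) := smul_left_injective ℝ hp0 <| by
    simpa only [D.dual.fst_inl_add_inr] using congrArg D.dual.fst hc
  have hbc : 4 / 5 * b = c * (4 / 5) := smul_left_injective ℝ hq0 <| by
    simpa only [D.dual.snd_inl_add_inr] using congrArg D.dual.snd hc
  obtain rfl : a = c := by linarith
  obtain rfl : b = a := by linarith
  exact ⟨b, ha, hb⟩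

theorem exists_forall_eigenvalue (D : L2Decomposition E F X) {T : X →L[ℝ] X}
    (hT : IsMultiplier T) :
    ∃ c : ℝ, (∀ p ∈ dualExtremePoints E, (D.dual.inl p).comp T = c • D.dual.inl p) ∧
      ∀ q ∈ dualExtremePoints F, (D.dual.inr q).comp T = c • D.dual.inr q := by
  obtain ⟨u, hu⟩ := exists_ne (0 : E)
  obtain ⟨v, hv⟩ := exists_ne (0 : F)
  obtain ⟨p₀, hp₀, hp₀u⟩ := exists_mem_dualExtremePoints_apply_ne_zero hu
  obtain ⟨q₀, hq₀, hq₀v⟩ := exists_mem_dualExtremePoints_apply_ne_zero hv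
  obtain ⟨c, hcp₀, hcq₀⟩ := D.exists_common_eigenvalue hT hp₀ hq₀
  have hp₀' : D.dual.inl p₀ ≠ 0 := fun h =>
    hp₀u ((congrArg p₀ (D.fst_inl u)).symm.trans (DFunLike.congr_fun h (D.inl u)))
  have hq₀' : D.dual.inr q₀ ≠ 0 := fun h =>
    hq₀v ((congrArg q₀ (D.snd_inr v)).symm.trans (DFunLike.congr_fun h (D.inr v)))
  refine ⟨c, fun p hp => ?_, fun q hq => ?_⟩
  · obtain ⟨d, hdp, hdq₀⟩ := D.exists_common_eigenvalue hT hp hq₀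
    rwa [smul_left_injective ℝ hq₀' (hcq₀.symm.trans hdq₀)]
  · obtain ⟨d, hdp₀, hdq⟩ := D.exists_common_eigenvalue hT hp₀ hq
    rwa [smul_left_injective ℝ hp₀' (hcp₀.symm.trans hdp₀)]

theorem exists_eq_smul_id_of_isMultiplier (D : L2Decomposition E F X) {T : X →L[ℝ] X}
    (hT : IsMultiplier T) : ∃ a : ℝ, T = a • ContinuousLinearMap.id ℝ X := by
  obtain ⟨a, hinl, hinr⟩ := D.exists_forall_eigenvalue hT
  refine ⟨a, ContinuousLinearMap.ext fun x => sub_eq_zero.1 ?_⟩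
  set w := T x - (a • ContinuousLinearMap.id ℝ X) x
  have apply_eq_zero {f : StrongDual ℝ X} (hf : f.comp T = a • f) : f w = 0 := by
    rw [map_sub, sub_eq_zero]
    exact (DFunLike.congr_fun hf x).trans (map_smul f a x).symm
  have hfst : D.fst w = 0 := by
    by_contra hw
    obtain ⟨p, hp, hpw⟩ := exists_mem_dualExtremePoints_apply_ne_zero hw
    exact hpw (apply_eq_zero (hinl p hp))
  have hsnd : D.snd w = 0 := by
    by_contra hw
    obtain ⟨q, hq, hqw⟩ := exists_mem_dualExtremePoints_apply_ne_zero hw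
    exact hqw (apply_eq_zero (hinr q hq))
  rw [← D.inl_fst_add_inr_snd w, hfst, hsnd, map_zero, map_zero, add_zero]

theorem rank_centralizer (D : L2Decomposition E F X) : Module.rank ℝ (centralizer X) = 1 := by
  have hid : ContinuousLinearMap.id ℝ X ∈ centralizer X :=
    ⟨ContinuousLinearMap.id ℝ X, fun p _ => ⟨1, by simp, by simp⟩⟩
  have := D.nontrivial
  obtain ⟨x, hx⟩ := exists_ne (0 : X)
  refine rank_eq_one (⟨_, hid⟩ : centralizer X) (fun h => hx ?_) ?_
  · exact DFunLike.congr_fun (congrArg Subtype.val h) x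
  · rintro ⟨T, S, hT⟩
    obtain ⟨a, rfl⟩ :=
      D.exists_eq_smul_id_of_isMultiplier fun p hp => (hT p hp).imp fun a ha => ha.1
    exact ⟨a, rfl⟩

end L2Decomposition

end Centralizer

section LSummand

variable {E F X : Type*} [NormedAddCommGroup E] [NormedSpace ℝ E]
  [NormedAddCommGroup F] [NormedSpace ℝ F] [NormedAddCommGroup X] [NormedSpace ℝ X]

namespace L2Decomposition

theorem snd_eq_zero_of_isLComplement (D : L2Decomposition E F X) {M N : Submodule ℝ X}
    (hMN : IsLComplement X M N) {a : E} (ha : a ≠ 0) (haM : D.inl a ∈ M) {z : X} (hz : z ∈ N) :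
    D.snd z = 0 := by
  have hsum : (‖a‖ + ‖z‖) ^ 2 = ‖a + D.fst z‖ ^ 2 + ‖D.snd z‖ ^ 2 := by
    rw [← D.norm_inl a, ← hMN.2 _ haM _ hz, D.norm_sq, map_add, map_add, D.fst_inl, D.snd_inl,
      zero_add]
  have hz_sq := D.norm_sq z
  have ha_pos := norm_pos_iff.2 ha
  have hle : ‖a + D.fst z‖ ^ 2 ≤ (‖a‖ + ‖D.fst z‖) ^ 2 := by
    gcongr
    exact norm_add_le _ _
  -- Comparing the cross terms of the two squares: `‖a‖ ‖z‖ ≤ ‖a‖ ‖fst z‖`.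
  have hnorm_le : ‖z‖ ≤ ‖D.fst z‖ := le_of_mul_le_mul_left (by linarith) ha_pos
  have hsq : ‖D.snd z‖ ^ 2 ≤ 0 := by
    have := pow_le_pow_left₀ (norm_nonneg z) hnorm_le 2
    linarith
  simpa using hsq

theorem eq_top_of_isLSummand (D : L2Decomposition E F X) {M : Submodule ℝ X}
    (hM : IsLSummand X M) {a : E} (ha : a ≠ 0) (haM : D.inl a ∈ M) {b : F} (hb : b ≠ 0)
    (hbM : D.inr b ∈ M) : M = ⊤ := by
  obtain ⟨N, hMN⟩ := hM
  have hN : N = ⊥ := (Submodule.eq_bot_iff N).2 fun z hz => by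
    have hsnd := D.snd_eq_zero_of_isLComplement hMN ha haM hz
    have hfst : D.fst z = 0 := D.symm.snd_eq_zero_of_isLComplement hMN hb hbM hz
    rw [← D.inl_fst_add_inr_snd z, hfst, hsnd, map_zero, map_zero, add_zero]
  rw [← sup_bot_eq M, ← hN, hMN.1.sup_eq_top]

theorem not_isLSummand_canonicalImage_strongDual [Nontrivial E] [Nontrivial F] [CompleteSpace X]
    (D : L2Decomposition E F X) (hX : canonicalImage X ≠ ⊤) :
    ¬ IsLSummand (StrongDual ℝ (StrongDual ℝ (StrongDual ℝ X)))
      (canonicalImage (StrongDual ℝ X)) := by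
  intro hL
  obtain ⟨f, hf⟩ := exists_ne (0 : StrongDual ℝ E)
  obtain ⟨g, hg⟩ := exists_ne (0 : StrongDual ℝ F)
  exact canonicalImage_strongDual_ne_top hX (D.dual.dual.dual.eq_top_of_isLSummand hL
    (a := inclusionInDoubleDual ℝ _ f) (inclusionInDoubleDual_ne_zero hf) ⟨D.dual.inl f, rfl⟩
    (b := inclusionInDoubleDual ℝ _ g) (inclusionInDoubleDual_ne_zero hg) ⟨D.dual.inr g, rfl⟩)

end L2Decomposition

end LSummand

section Daugavet

variable {E F X : Type*} [NormedAddCommGroup E] [NormedSpace ℝ E]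
  [NormedAddCommGroup F] [NormedSpace ℝ F] [NormedAddCommGroup X] [NormedSpace ℝ X]

theorem rank_smulRight {f : StrongDual ℝ E} (hf : f ≠ 0) {x : X} (hx : x ≠ 0) :
    LinearMap.rank (f.smulRight x : E →ₗ[ℝ] X) = 1 := by
  rw [LinearMap.rank, ContinuousLinearMap.range_smulRight_apply hf]
  exact (rank_submodule_eq_one_iff _).2 ⟨x, Submodule.mem_span_singleton_self x, hx, le_rfl⟩

theorem L2Decomposition.not_hasDaugavetProperty [Nontrivial E] [Nontrivial F]
    (D : L2Decomposition E F X) : ¬ HasDaugavetProperty X := by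
  intro hX
  obtain ⟨φ, hφ⟩ := exists_norm_eq (StrongDual ℝ E) zero_le_one
  obtain ⟨u, hu⟩ := exists_norm_eq F zero_le_one
  have hψ : ‖D.dual.inl φ‖ = 1 := (D.dual.norm_inl φ).trans hφ
  have hv : ‖D.inr u‖ = 1 := (D.norm_inr u).trans hu
  let T : X →L[ℝ] X := (D.dual.inl φ).smulRight (D.inr u)
  have hT : ‖T‖ = 1 := by rw [ContinuousLinearMap.norm_smulRight_apply, hψ, hv, one_mul]
  have hrank : LinearMap.rank (T : X →ₗ[ℝ] X) = 1 :=
    rank_smulRight (norm_ne_zero_iff.1 (hψ.trans_ne one_ne_zero))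
      (norm_ne_zero_iff.1 (hv.trans_ne one_ne_zero))
  have hle : ‖ContinuousLinearMap.id ℝ X + T‖ ≤ √3 := by
    refine ContinuousLinearMap.opNorm_le_bound _ (by positivity) fun x => ?_
    have hx : (ContinuousLinearMap.id ℝ X + T) x =
        D.inl (D.fst x) + D.inr (D.snd x + φ (D.fst x) • u) := by
      rw [map_add, ← add_assoc, D.inl_fst_add_inr_snd, map_smul]
      rfl
    have hsnd : ‖D.snd x + φ (D.fst x) • u‖ ≤ ‖D.snd x‖ + ‖D.fst x‖ := by
      refine norm_add_le_of_le le_rfl ?_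
      rw [norm_smul, hu, mul_one]
      exact (φ.le_opNorm _).trans_eq (by rw [hφ, one_mul])
    rw [← sq_le_sq₀ (norm_nonneg _) (by positivity), mul_pow, Real.sq_sqrt (by norm_num), hx,
      D.norm_inl_add_inr_sq, D.norm_sq x]
    calc ‖D.fst x‖ ^ 2 + ‖D.snd x + φ (D.fst x) • u‖ ^ 2
        ≤ ‖D.fst x‖ ^ 2 + (‖D.snd x‖ + ‖D.fst x‖) ^ 2 := by gcongr
      _ ≤ 3 * (‖D.fst x‖ ^ 2 + ‖D.snd x‖ ^ 2) := by
        nlinarith [sq_nonneg (‖D.snd x‖ - ‖D.fst x‖)]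
  rw [hX T hrank, hT] at hle
  have hlt : √3 < 2 := by rw [Real.sqrt_lt' (by norm_num)]; norm_num
  linarith

end Daugavet

section UniformAlgebra

/-- Local almost squareness, in homogeneous form: every vector `x` has an approximate `ℓ^∞`-partner
`y` of the same norm. -/
def IsLocallyAlmostSquare (E : Type*) [NormedAddCommGroup E] : Prop :=
  ∀ x : E, ∀ ε > 0, ∃ y : E, ‖y‖ = ‖x‖ ∧ ‖x + y‖ ≤ ‖x‖ + ε ∧ ‖x - y‖ ≤ ‖x‖ + ε

theorem L2Decomposition.isLocallyAlmostSquare {E F X : Type*} [NormedAddCommGroup E]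
    [NormedSpace ℝ E] [NormedAddCommGroup F] [NormedSpace ℝ F] [NormedAddCommGroup X]
    [NormedSpace ℝ X] (D : L2Decomposition E F X) (hE : IsLocallyAlmostSquare E)
    (hF : IsLocallyAlmostSquare F) : IsLocallyAlmostSquare X := by
  intro x ε hε
  obtain ⟨a, ha, ha_add, ha_sub⟩ := hE (D.fst x) (ε / 2) (half_pos hε)
  obtain ⟨b, hb, hb_add, hb_sub⟩ := hF (D.snd x) (ε / 2) (half_pos hε)
  have norm_le {z : X} (hfst : ‖D.fst z‖ ≤ ‖D.fst x‖ + ε / 2)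
      (hsnd : ‖D.snd z‖ ≤ ‖D.snd x‖ + ε / 2) : ‖z‖ ≤ ‖x‖ + ε := by
    have hfst_le : ‖D.fst x‖ ≤ ‖x‖ :=
      abs_le_of_sq_le_sq' (by nlinarith [D.norm_sq x]) (norm_nonneg x) |>.2
    have hsnd_le : ‖D.snd x‖ ≤ ‖x‖ :=
      abs_le_of_sq_le_sq' (by nlinarith [D.norm_sq x]) (norm_nonneg x) |>.2
    rw [← sq_le_sq₀ (norm_nonneg z) (by positivity)]
    calc ‖z‖ ^ 2 = ‖D.fst z‖ ^ 2 + ‖D.snd z‖ ^ 2 := D.norm_sq z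
      _ ≤ (‖D.fst x‖ + ε / 2) ^ 2 + (‖D.snd x‖ + ε / 2) ^ 2 := by gcongr
      _ ≤ (‖x‖ + ε) ^ 2 := by nlinarith [D.norm_sq x]
  refine ⟨D.inl a + D.inr b, ?_, norm_le ?_ ?_, norm_le ?_ ?_⟩
  · rw [← sq_eq_sq₀ (norm_nonneg _) (norm_nonneg _), D.norm_inl_add_inr_sq, ha, hb, D.norm_sq x]
  · rwa [map_add, D.fst_inl_add_inr]
  · rwa [map_add, D.snd_inl_add_inr]
  · rwa [map_sub, D.fst_inl_add_inr]
  · rwa [map_sub, D.snd_inl_add_inr]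

theorem two_add_two_mul_norm_sq_le_norm_one_add_sq_add_norm_one_sub_sq {K 𝕜 : Type*}
    [TopologicalSpace K] [CompactSpace K] [Nonempty K] [RCLike 𝕜] (v : C(K, 𝕜)) :
    2 + 2 * ‖v‖ ^ 2 ≤ ‖1 + v‖ ^ 2 + ‖1 - v‖ ^ 2 := by
  obtain ⟨k, -, hmax⟩ :=
    isCompact_univ.exists_isMaxOn Set.univ_nonempty v.continuous.norm.continuousOn
  have hk : ‖v‖ = ‖v k‖ := le_antisymm
    ((v.norm_le (norm_nonneg _)).2 fun m => hmax (Set.mem_univ m)) (v.norm_coe_le_norm k)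
  have hparallelogram := parallelogram_law_with_norm 𝕜 1 (v k)
  have hadd : ‖1 + v k‖ ^ 2 ≤ ‖1 + v‖ ^ 2 := by
    gcongr
    exact (1 + v).norm_coe_le_norm k
  have hsub : ‖1 - v k‖ ^ 2 ≤ ‖1 - v‖ ^ 2 := by
    gcongr
    exact (1 - v).norm_coe_le_norm k
  rw [norm_one, ← hk] at hparallelogram
  linarith

theorem IsLocallyAlmostSquare.not_isUniformAlgebra {X : Type u} [NormedAddCommGroup X]
    [NormedSpace ℝ X] [Nontrivial X] (hX : IsLocallyAlmostSquare X) (𝕜 : Type) [RCLike 𝕜] :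
    ¬ IsUniformAlgebra X 𝕜 := by
  rintro ⟨K, _, _, _, A, -, -, φ, hφ⟩
  obtain ⟨u, hu⟩ : (1 : C(K, 𝕜)) ∈ Set.range φ := hφ ▸ A.one_mem
  have : Nonempty K := by
    by_contra hK
    rw [not_nonempty_iff] at hK
    exact not_subsingleton X φ.injective.subsingleton
  have hu_norm : ‖u‖ = 1 := by rw [← φ.norm_map, hu, norm_one]
  obtain ⟨v, hv, hadd, hsub⟩ := hX u (1 / 4) (by norm_num)
  have hparallelogram := two_add_two_mul_norm_sq_le_norm_one_add_sq_add_norm_one_sub_sq (φ v)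
  rw [← hu, ← map_add, ← map_sub, φ.norm_map, φ.norm_map, φ.norm_map, hv, hu_norm]
    at hparallelogram
  rw [hu_norm] at hadd hsub
  nlinarith [norm_nonneg (u + v), norm_nonneg (u - v)]

end UniformAlgebra

section DiameterTwo

variable {E F X : Type*} [NormedAddCommGroup E] [NormedSpace ℝ E]
  [NormedAddCommGroup F] [NormedSpace ℝ F] [NormedAddCommGroup X] [NormedSpace ℝ X]

theorem hasDiameterTwoProperty_of_forall_exists_le_norm_sub
    (h : ∀ U : Set (WeakSpace ℝ X), IsOpen U → ∀ x : X, toWeakSpace ℝ X x ∈ U → ‖x‖ ≤ 1 →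
      ∀ c, 0 ≤ c → c < 1 → ∃ y z : X, toWeakSpace ℝ X y ∈ U ∧ toWeakSpace ℝ X z ∈ U ∧
        ‖y‖ ≤ 1 ∧ ‖z‖ ≤ 1 ∧ c * 2 ≤ ‖y - z‖) : HasDiameterTwoProperty X := by
  rintro U hU ⟨x, hxU, hx⟩
  refine le_antisymm ?_ (le_of_forall_lt fun d hd => ?_)
  · calc _ ≤ Metric.diam (Metric.closedBall (0 : X) 1) :=
          Metric.diam_mono Set.inter_subset_right Metric.isBounded_closedBall
      _ ≤ 2 * 1 := Metric.diam_closedBall zero_le_one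
      _ = 2 := mul_one 2
  · obtain ⟨c, hdc, hc⟩ := exists_between (max_lt ((div_lt_one two_pos).2 hd) one_pos)
    obtain ⟨y, z, hyU, hzU, hy, hz, hyz⟩ :=
      h U hU x hxU (mem_closedBall_zero_iff.1 hx) c ((le_max_right _ _).trans hdc.le) hc
    calc d < c * 2 := (div_lt_iff₀ two_pos).1 ((le_max_left _ _).trans_lt hdc)
      _ ≤ dist y z := by rwa [dist_eq_norm]
      _ ≤ _ := Metric.dist_le_diam_of_mem
        (Metric.isBounded_closedBall.subset Set.inter_subset_right)
        ⟨hyU, mem_closedBall_zero_iff.2 hy⟩ ⟨hzU, mem_closedBall_zero_iff.2 hz⟩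

theorem HasDiameterTwoProperty.exists_le_norm_sub (h : HasDiameterTwoProperty X)
    {U : Set (WeakSpace ℝ X)} (hU : IsOpen U) {x : X} (hxU : toWeakSpace ℝ X x ∈ U) {r : ℝ}
    (hx : ‖x‖ ≤ r) {c : ℝ} (hc : c < 1) :
    ∃ y z : X, toWeakSpace ℝ X y ∈ U ∧ toWeakSpace ℝ X z ∈ U ∧ ‖y‖ ≤ r ∧ ‖z‖ ≤ r ∧
      c * (2 * r) ≤ ‖y - z‖ := by
  rcases ((norm_nonneg x).trans hx).eq_or_lt with rfl | hr
  · exact ⟨x, x, hxU, hxU, hx, hx, by simp⟩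
  have norm_smul_le {y : X} (hy : ‖y‖ ≤ 1) : ‖r • y‖ ≤ r := by
    rw [norm_smul, Real.norm_of_nonneg hr.le]
    exact mul_le_of_le_one_right hr.le hy
  set S := toWeakSpace ℝ X ⁻¹' ((r • ·) ⁻¹' U) ∩ Metric.closedBall (0 : X) 1
  have hS : S.Nonempty := by
    refine ⟨r⁻¹ • x, ?_, ?_⟩
    · rwa [Set.mem_preimage, Set.mem_preimage, ← map_smul, smul_inv_smul₀ hr.ne']
    · rw [mem_closedBall_zero_iff, norm_smul, norm_inv, Real.norm_of_nonneg hr.le]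
      exact inv_mul_le_one_of_le₀ hx hr.le
  have hdiam : Metric.diam S = 2 := h _ (hU.preimage (continuous_const_smul r)) hS
  obtain ⟨y, hy, z, hz, hyz⟩ : ∃ y ∈ S, ∃ z ∈ S, c * 2 < dist y z := by
    by_contra! hle
    linarith [Metric.diam_le_of_forall_dist_le_of_nonempty hS hle]
  refine ⟨r • y, r • z, ?_, ?_, norm_smul_le (mem_closedBall_zero_iff.1 hy.2),
    norm_smul_le (mem_closedBall_zero_iff.1 hz.2), ?_⟩
  · rw [map_smul]; exact hy.1
  · rw [map_smul]; exact hz.1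
  · rw [← smul_sub, norm_smul, Real.norm_of_nonneg hr.le, ← dist_eq_norm]
    linarith [mul_le_mul_of_nonneg_left hyz.le hr.le]

theorem L2Decomposition.hasDiameterTwoProperty (D : L2Decomposition E F X)
    (hE : HasDiameterTwoProperty E) (hF : HasDiameterTwoProperty F) :
    HasDiameterTwoProperty X := by
  refine hasDiameterTwoProperty_of_forall_exists_le_norm_sub fun U hU x hxU hx c hc₀ hc => ?_
  let g : WeakSpace ℝ E × WeakSpace ℝ F → WeakSpace ℝ X := fun p =>
    WeakSpace.map D.inl p.1 + WeakSpace.map D.inr p.2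
  have hg : Continuous g := by fun_prop
  have hgx : g (toWeakSpace ℝ E (D.fst x), toWeakSpace ℝ F (D.snd x)) ∈ U := by
    rwa [← D.inl_fst_add_inr_snd x] at hxU
  obtain ⟨V, W, hV, hW, hxV, hxW, hVW⟩ := isOpen_prod_iff.1 (hU.preimage hg) _ _ hgx
  have hx_sq : ‖D.fst x‖ ^ 2 + ‖D.snd x‖ ^ 2 ≤ 1 :=
    (D.norm_sq x).symm.trans_le (pow_le_one₀ (norm_nonneg x) hx)
  have mem_U {a : E} {b : F} (ha : toWeakSpace ℝ E a ∈ V) (hb : toWeakSpace ℝ F b ∈ W) :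
      toWeakSpace ℝ X (D.inl a + D.inr b) ∈ U :=
    hVW (Set.mk_mem_prod ha hb)
  set r := √(1 - ‖D.snd x‖ ^ 2)
  have hr : r ^ 2 = 1 - ‖D.snd x‖ ^ 2 := Real.sq_sqrt (by nlinarith)
  obtain ⟨a₁, a₂, ha₁V, ha₂V, ha₁, ha₂, ha⟩ :=
    hE.exists_le_norm_sub hV hxV (Real.le_sqrt_of_sq_le (by linarith) : ‖D.fst x‖ ≤ r) hc
  obtain ⟨b₁, b₂, hb₁W, hb₂W, hb₁, hb₂, hb⟩ := hF.exists_le_norm_sub hW hxW le_rfl hc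
  have norm_le {a : E} {b : F} (ha : ‖a‖ ≤ r) (hb : ‖b‖ ≤ ‖D.snd x‖) :
      ‖D.inl a + D.inr b‖ ≤ 1 := by
    rw [← sq_le_one_iff₀ (norm_nonneg _), D.norm_inl_add_inr_sq]
    calc ‖a‖ ^ 2 + ‖b‖ ^ 2 ≤ r ^ 2 + ‖D.snd x‖ ^ 2 := by gcongr
      _ = 1 := by rw [hr, sub_add_cancel]
  refine ⟨D.inl a₁ + D.inr b₁, D.inl a₂ + D.inr b₂, mem_U ha₁V hb₁W, mem_U ha₂V hb₂W,
    norm_le ha₁ hb₁, norm_le ha₂ hb₂, ?_⟩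
  rw [← sq_le_sq₀ (by positivity) (norm_nonneg _), add_sub_add_comm, ← map_sub, ← map_sub,
    D.norm_inl_add_inr_sq]
  calc (c * 2) ^ 2 = (c * (2 * r)) ^ 2 + (c * (2 * ‖D.snd x‖)) ^ 2 := by
        rw [mul_pow c (2 * r), mul_pow 2 r, hr]; ring
    _ ≤ ‖a₁ - a₂‖ ^ 2 + ‖b₁ - b₂‖ ^ 2 := by gcongr

end DiameterTwo

namespace CZero

variable {ι : Type*} [TopologicalSpace ι]

theorem norm_le {x : C₀(ι, ℝ)} {C : ℝ} (hC : 0 ≤ C) : ‖x‖ ≤ C ↔ ∀ i, ‖x i‖ ≤ C := by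
  rw [← ZeroAtInftyContinuousMap.norm_toBCF_eq_norm, BoundedContinuousFunction.norm_le hC]
  rfl

theorem norm_apply_le (x : C₀(ι, ℝ)) (i : ι) : ‖x i‖ ≤ ‖x‖ :=
  (norm_le (norm_nonneg x)).1 le_rfl i

/-- The coordinate functional `x ↦ x i` on `c₀(ι)`. -/
def coord (i : ι) : StrongDual ℝ C₀(ι, ℝ) :=
  LinearMap.mkContinuous ⟨⟨fun x => x i, fun _ _ => rfl⟩, fun _ _ => rfl⟩ 1
    fun x => by rw [one_mul]; exact norm_apply_le x i

theorem coord_apply (i : ι) (x : C₀(ι, ℝ)) : coord i x = x i := rfl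

theorem norm_coord_le (i : ι) : ‖coord i‖ ≤ 1 := LinearMap.mkContinuous_norm_le _ zero_le_one _

variable [DiscreteTopology ι]

theorem tendsto_zero (x : C₀(ι, ℝ)) : Tendsto x cofinite (𝓝 0) := by
  rw [← cocompact_eq_cofinite]
  exact x.zero_at_infty'

section UnitVectors

variable [DecidableEq ι]

/-- The unit vector of `c₀(ι)` supported at `i`. -/
def unitVector (i : ι) : C₀(ι, ℝ) where
  toFun := Pi.single i 1
  continuous_toFun := continuous_of_discreteTopology
  zero_at_infty' := by
    rw [cocompact_eq_cofinite]
    refine tendsto_const_nhds.congr' ?_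
    filter_upwards [(Set.finite_singleton i).compl_mem_cofinite] with j hj
    exact (Pi.single_eq_of_ne (M := fun _ => ℝ) hj 1).symm

theorem unitVector_apply (i j : ι) : unitVector i j = if j = i then 1 else 0 :=
  Pi.single_apply i (1 : ℝ) j

theorem unitVector_self (i : ι) : unitVector i i = 1 := by rw [unitVector_apply, if_pos rfl]

theorem norm_smul_unitVector (c : ℝ) (i : ι) : ‖c • unitVector i‖ = |c| := by
  apply le_antisymm
  · refine (norm_le (abs_nonneg c)).2 fun j => ?_
    rw [ZeroAtInftyContinuousMap.smul_apply, unitVector_apply]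
    split_ifs <;> simp
  · have := norm_apply_le (c • unitVector i) i
    rwa [ZeroAtInftyContinuousMap.smul_apply, unitVector_self, smul_eq_mul, mul_one] at this

theorem norm_add_sub_smul_unitVector_le (x : C₀(ι, ℝ)) (i : ι) {c t : ℝ} (hx : ‖x‖ ≤ t)
    (hc : |c| ≤ t) : ‖x + (c - x i) • unitVector i‖ ≤ t := by
  refine (norm_le ((abs_nonneg c).trans hc)).2 fun j => ?_
  rw [ZeroAtInftyContinuousMap.add_apply, ZeroAtInftyContinuousMap.smul_apply, unitVector_apply]
  split_ifs with h
  · subst h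
    simpa using hc
  · simpa using (norm_apply_le x j).trans hx

theorem norm_add_smul_unitVector_le (x : C₀(ι, ℝ)) (i : ι) {c : ℝ} (hc : |c| ≤ ‖x‖) :
    ‖x + c • unitVector i‖ ≤ ‖x‖ + |x i| :=
  calc ‖x + c • unitVector i‖ = ‖x + (c - x i) • unitVector i + x i • unitVector i‖ := by
        rw [add_assoc, ← add_smul, sub_add_cancel]
    _ ≤ ‖x‖ + |x i| :=
        norm_add_le_of_le (norm_add_sub_smul_unitVector_le x i le_rfl hc)
          (norm_smul_unitVector _ i).le

theorem sum_smul_unitVector_apply (s : Finset ι) (a : ι → ℝ) (j : ι) :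
    (∑ i ∈ s, a i • unitVector i) j = if j ∈ s then a j else 0 := by
  rw [← coord_apply, map_sum]
  simp [coord_apply, unitVector_apply]

theorem sum_norm_apply_unitVector_le (f : StrongDual ℝ C₀(ι, ℝ)) (s : Finset ι) :
    ∑ i ∈ s, ‖f (unitVector i)‖ ≤ ‖f‖ := by
  let x : C₀(ι, ℝ) := ∑ i ∈ s, (SignType.sign (f (unitVector i)) : ℝ) • unitVector i
  have hx : ‖x‖ ≤ 1 := by
    refine (norm_le zero_le_one).2 fun j => ?_
    rw [sum_smul_unitVector_apply]
    split_ifs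
    · rcases SignType.sign (f (unitVector j)) with _ | _ | _ <;> simp
    · simp
  calc ∑ i ∈ s, ‖f (unitVector i)‖ = f x := by
        simp only [x, map_sum, map_smul, smul_eq_mul, sign_mul_self, Real.norm_eq_abs]
    _ ≤ ‖f‖ := (le_abs_self _).trans (f.unit_le_opNorm x hx)

theorem summable_norm_apply_unitVector (f : StrongDual ℝ C₀(ι, ℝ)) :
    Summable fun i => ‖f (unitVector i)‖ :=
  summable_of_sum_le (fun _ => norm_nonneg _) (sum_norm_apply_unitVector_le f)

theorem tendsto_apply_unitVector (f : StrongDual ℝ C₀(ι, ℝ)) :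
    Tendsto (fun i => f (unitVector i)) cofinite (𝓝 0) :=
  (summable_norm_apply_unitVector f).of_norm.tendsto_cofinite_zero

/-- The projection of `c₀(ι)` onto the span of the unit vectors indexed by `s`. -/
def truncation (s : Finset ι) : C₀(ι, ℝ) →L[ℝ] C₀(ι, ℝ) :=
  ∑ i ∈ s, (coord i).smulRight (unitVector i)

theorem truncation_apply (s : Finset ι) (x : C₀(ι, ℝ)) (j : ι) :
    truncation s x j = if j ∈ s then x j else 0 := by
  rw [truncation, sum_apply]
  exact sum_smul_unitVector_apply s x j

theorem tendsto_truncation (x : C₀(ι, ℝ)) : Tendsto (fun s => truncation s x) atTop (𝓝 x) := by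
  refine Metric.tendsto_atTop.2 fun ε hε => ?_
  have hfinite : {i | ¬ ‖x i‖ < ε / 2}.Finite :=
    (tendsto_zero_iff_norm_tendsto_zero.1 (tendsto_zero x)).eventually_lt_const (half_pos hε)
  refine ⟨hfinite.toFinset, fun s hs => ?_⟩
  rw [dist_eq_norm]
  refine ((norm_le (half_pos hε).le).2 fun j => ?_).trans_lt (half_lt_self hε)
  rw [ZeroAtInftyContinuousMap.sub_apply, truncation_apply]
  split_ifs with hj
  · simpa using (half_pos hε).le
  · rw [zero_sub, norm_neg]
    by_contra! h
    exact hj (hs (hfinite.mem_toFinset.2 h.not_gt))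

theorem tendsto_comp_truncation (f : StrongDual ℝ C₀(ι, ℝ)) :
    Tendsto (fun s => f.comp (truncation s)) atTop (𝓝 f) := by
  obtain ⟨g, hg⟩ : Summable fun i => f (unitVector i) • coord i := by
    refine Summable.of_norm_bounded (summable_norm_apply_unitVector f) fun i => ?_
    rw [norm_smul]
    exact mul_le_of_le_one_right (norm_nonneg _) (norm_coord_le i)
  have hsum (s : Finset ι) : f.comp (truncation s) = ∑ i ∈ s, f (unitVector i) • coord i := by
    ext x
    simp [truncation, mul_comm]
  have hlim : Tendsto (fun s => f.comp (truncation s)) atTop (𝓝 g) := by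
    simpa only [hsum] using! hg
  have hgf : g = f := ContinuousLinearMap.ext fun x =>
    tendsto_nhds_unique (((ContinuousLinearMap.apply ℝ ℝ x).continuous.tendsto g).comp hlim)
      ((f.continuous.tendsto x).comp (tendsto_truncation x))
  rwa [hgf] at hlim

theorem norm_sub_two_smul_truncation_le (s : Finset ι) (x : C₀(ι, ℝ)) :
    ‖x - (2 : ℝ) • truncation s x‖ ≤ ‖x‖ := by
  refine (norm_le (norm_nonneg x)).2 fun j => le_of_eq_of_le ?_ (norm_apply_le x j)
  rw [ZeroAtInftyContinuousMap.sub_apply, ZeroAtInftyContinuousMap.smul_apply, truncation_apply]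
  split_ifs
  · rw [smul_eq_mul, two_mul, sub_add_cancel_left, norm_neg]
  · simp

theorem truncation_mem_weaklyCompactOperators (s : Finset ι) :
    truncation s ∈ weaklyCompactOperators C₀(ι, ℝ) C₀(ι, ℝ) :=
  sum_mem fun _ _ => smulRight_mem_weaklyCompactOperators _ _

/-- The element of `c₀(ι)** = ℓ^∞(ι)` whose coordinates are all `1`. -/
def sumCoordinates : StrongDual ℝ (StrongDual ℝ C₀(ι, ℝ)) :=
  LinearMap.mkContinuous
    { toFun := fun f => ∑' i, f (unitVector i)
      map_add' := fun f g => (summable_norm_apply_unitVector f).of_norm.tsum_add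
        (summable_norm_apply_unitVector g).of_norm
      map_smul' := fun c f => tsum_mul_left } 1 fun f => by
    rw [one_mul]
    exact (norm_tsum_le_tsum_norm (summable_norm_apply_unitVector f)).trans
      ((summable_norm_apply_unitVector f).tsum_le_of_sum_le (sum_norm_apply_unitVector_le f))

theorem sumCoordinates_coord (i : ι) : sumCoordinates (coord i) = 1 := by
  change ∑' j, coord i (unitVector j) = 1
  rw [tsum_eq_single i fun j hj => ?_]
  · exact unitVector_self i
  · rw [coord_apply, unitVector_apply, if_neg hj.symm]

theorem tendsto_toWeakSpace_add_smul_unitVector (x : C₀(ι, ℝ)) (c : ℝ) :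
    Tendsto (fun i => toWeakSpace ℝ C₀(ι, ℝ) (x + (c - x i) • unitVector i)) cofinite
      (𝓝 (toWeakSpace ℝ C₀(ι, ℝ) x)) := by
  refine (WeakBilin.tendsto_iff_forall_eval_tendsto (topDualPairing ℝ C₀(ι, ℝ)).flip
    fun y z h => ?_).2 fun f => ?_
  · exact SeparatingDual.eq_iff_forall_dual_eq (R := ℝ) |>.2 fun g => DFunLike.congr_fun h g
  · change Tendsto (fun i => f (x + (c - x i) • unitVector i)) cofinite (𝓝 (f x))
    simpa using (((tendsto_const_nhds (x := c)).sub (tendsto_zero x)).mul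
      (tendsto_apply_unitVector f)).const_add (f x)

end UnitVectors

instance instNontrivial [Nonempty ι] : Nontrivial C₀(ι, ℝ) := by
  classical
  obtain ⟨i⟩ := ‹Nonempty ι›
  exact ⟨unitVector i, 0, fun h =>
    one_ne_zero ((unitVector_self i).symm.trans (DFunLike.congr_fun h i))⟩

theorem isStrictUIdealInBidual (ι : Type*) [TopologicalSpace ι] [DiscreteTopology ι] :
    IsStrictUIdealInBidual C₀(ι, ℝ) := by
  classical
  refine isStrictUIdealInBidual_of_tendsto (fun s => ?_) truncation_mem_weaklyCompactOperators
    tendsto_comp_truncation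
  refine ContinuousLinearMap.opNorm_le_bound _ zero_le_one fun x => ?_
  rw [one_mul]
  exact norm_sub_two_smul_truncation_le s x

variable [Infinite ι]

variable (ι) in
theorem canonicalImage_ne_top : canonicalImage C₀(ι, ℝ) ≠ ⊤ := by
  classical
  intro htop
  obtain ⟨x, hx⟩ : sumCoordinates ∈ canonicalImage C₀(ι, ℝ) := htop ▸ Submodule.mem_top
  have hx_one : ⇑x = fun _ => 1 := funext fun i =>
    (DFunLike.congr_fun hx (coord i)).trans (sumCoordinates_coord i)
  have hlim := tendsto_zero x
  rw [hx_one] at hlim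
  exact one_ne_zero (tendsto_nhds_unique tendsto_const_nhds hlim)

variable (ι) in
theorem isLocallyAlmostSquare : IsLocallyAlmostSquare C₀(ι, ℝ) := by
  classical
  intro x ε hε
  obtain ⟨i, hi⟩ := ((tendsto_zero x).abs.eventually_lt_const (u := ε) (by simpa using hε)).exists
  refine ⟨‖x‖ • unitVector i, by rw [norm_smul_unitVector, abs_norm], ?_, ?_⟩
  · exact (norm_add_smul_unitVector_le x i (abs_norm x).le).trans (by gcongr)
  · rw [sub_eq_add_neg, ← neg_smul]
    exact (norm_add_smul_unitVector_le x i (by rw [abs_neg, abs_norm])).trans (by gcongr)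

variable (ι) in
theorem hasDiameterTwoProperty : HasDiameterTwoProperty C₀(ι, ℝ) := by
  classical
  refine hasDiameterTwoProperty_of_forall_exists_le_norm_sub fun U hU x hxU hx c _ hc => ?_
  have hev (a : ℝ) := (tendsto_toWeakSpace_add_smul_unitVector x a).eventually (hU.mem_nhds hxU)
  obtain ⟨i, hi, hi'⟩ := ((hev 1).and (hev (-1))).exists
  refine ⟨_, _, hi, hi', norm_add_sub_smul_unitVector_le x i hx (by simp),
    norm_add_sub_smul_unitVector_le x i hx (by simp), ?_⟩
  rw [add_sub_add_left_eq_sub, ← sub_smul, norm_smul_unitVector, sub_sub_sub_cancel_right]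
  have htwo : |1 - (-1 : ℝ)| = 2 := by norm_num
  linarith

end CZero

end

theorem mainTheorem7 :
    IsStrictUIdealInBidual CZeroSumTwo ∧
    HasDiameterTwoProperty CZeroSumTwo ∧
    ¬ IsLSummand (StrongDual ℝ (StrongDual ℝ (StrongDual ℝ CZeroSumTwo)))
      (canonicalImage (StrongDual ℝ CZeroSumTwo)) ∧
    (⨆ n : ℕ, Module.rank ℝ (centralizer (evenDual CZeroSumTwo n).carrier)) = 1 ∧
    (¬ IsUniformAlgebra CZeroSumTwo ℝ ∧ ¬ IsUniformAlgebra CZeroSumTwo ℂ) ∧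
    ¬ HasDaugavetProperty CZeroSumTwo := by
  let D : L2Decomposition C₀(ℕ, ℝ) C₀(ℕ, ℝ) CZeroSumTwo := .prod _ _
  have : Nontrivial CZeroSumTwo := D.nontrivial
  have hideal := CZero.isStrictUIdealInBidual ℕ
  have hdiam := CZero.hasDiameterTwoProperty ℕ
  have hsquare : IsLocallyAlmostSquare CZeroSumTwo :=
    D.isLocallyAlmostSquare (CZero.isLocallyAlmostSquare ℕ) (CZero.isLocallyAlmostSquare ℕ)
  have hreflexive : canonicalImage CZeroSumTwo ≠ ⊤ :=
    canonicalImage_ne_top_of_leftInverse D.fst_inl (CZero.canonicalImage_ne_top ℕ)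
  have hrank (n : ℕ) : Module.rank ℝ (centralizer (evenDual CZeroSumTwo n).carrier) = 1 :=
    (D.evenDual n).rank_centralizer
  exact ⟨D.isStrictUIdealInBidual hideal hideal, D.hasDiameterTwoProperty hdiam hdiam,
    D.not_isLSummand_canonicalImage_strongDual hreflexive, by simp only [hrank, ciSup_const],
    ⟨hsquare.not_isUniformAlgebra ℝ, hsquare.not_isUniformAlgebra ℂ⟩,
    D.not_hasDaugavetProperty⟩
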